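/- Let $\mathcal{F}$ be the set of cumulative distribution functions (cdfs) on $\mathbb{R}$, i.e. of non-decreasing right-continuous maps $F:\mathbb{R}\to\mathbb{R}$ with $\lim_{x\to-\infty}F(x)=0$ and $\lim_{x\to\infty}F(x)=1$, and let $\mathcal{F}_c\subset\mathcal{F}$ be the set of continuous cdfs. For $F,G\in\mathcal{F}$ write $D_u(F,G)=\sup_{x}|F(x)-G(x)|$ and $(F\star G)(x)=\int F(x-y)\,dG(y)$; if $G\in\mathcal{F}_c$, then $F\star G\in\mathcal{F}_c$. The weak topology on $\mathcal{F}$ is the initial topology for the maps $F\mapsto\int h\,dF$, $h:\mathbb{R}\to\mathbb{R}$ bounded and continuous. An approach system on a set $X$ assigns to each $x\in X$ an ideal $\mathcal{A}_x$ of functions $X\to[0,\infty]$ (containing $0$, closed under finite suprema and under passing to smaller functions) such that: $\phi(x)=0$ for all $\phi\in\mathcal{A}_x$; if for all $\epsilon>0$ and $\omega<\infty$ there is $\psi\in\mathcal{A}_x$ with $\min(\phi,\omega)\le\psi+\epsilon$, then $\phi\in\mathcal{A}_x$; and for all $\phi\in\mathcal{A}_x$, $\epsilon>0$, $\omega<\infty$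 there are $\phi_z\in\mathcal{A}_z$ $(z\in X)$ with $\min(\phi(y),\omega)\le\phi_x(z)+\phi_z(y)+\epsilon$ for all $y,z\in X$. A map $f$ from a space with approach system $\mathcal{A}$ to one with approach system $\mathcal{A}'$ is a contraction if $\psi\circ f\in\mathcal{A}_x$ for all $x$ and all $\psi\in\mathcal{A}'_{f(x)}$. A metric $d$ induces the approach system $\mathcal{A}_x=\{\phi\mid\phi\le d(x,\cdot)\}$. The continuity approach structure $\mathcal{A}_c$ on $\mathcal{F}$ is the initial approach structure for the maps $\mathcal{F}\to(\mathcal{F}_c,D_u):F\mapsto F\star G$, $G\in\mathcal{F}_c$, i.e. the smallest approach system (pointwise with respect to inclusion) for which all these maps are contractions. A sequence $(F_n)_n$ in $\mathcal{F}$ is $\epsilon$-convergent to $F\in\mathcal{F}$ if for each $\phi\in(\mathcal{A}_c)_F$ one has $\phi(F_n)<\epsilon$ for all sufficiently large $n$. For $\mathcal{D}\subset\mathcal{F}$ let $\chi_{rsc}(\mathcal{D})$ be the infimum of the real numbers $\alpha>0$ for which each sequence in $\mathcal{D}$ has a subsequence that is $\alpha$-convergent to some point of $\mathcal{F}$, and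 let $\chi_{rc}(\mathcal{D})$ be the infimum of the real numbers $\alpha>0$ such that for each choice of functions $\phi_F\in(\mathcal{A}_c)_F$ $(F\in\mathcal{F})$ there is a finite set $\mathcal{E}\subset\mathcal{F}$ with $\mathcal{D}\subset\bigcup_{F\in\mathcal{E}}\{G\in\mathcal{F}\mid\phi_F(G)<\alpha\}$. **Theorem.** For every set $\mathcal{D}\subset\mathcal{F}$ we have $\chi_{rsc}(\mathcal{D})=\chi_{rc}(\mathcal{D})$. Furthermore, each sequence in $\mathcal{D}$ has a subsequence that converges in the weak topology to an element of $\mathcal{F}$ if and only if $\chi_{rsc}(\mathcal{D})=0$. -/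

import Mathlib

open MeasureTheory Filter Topology Set
open scoped ENNReal BoundedContinuousFunction

/-- An approach space structure on `X`, presented by its approach system: to every point `x`
is assigned a saturated ideal `sys x` of functions `X → [0, ∞]` such that every member of
`sys x` vanishes at `x` and the mixed triangle inequality holds. -/
@[ext]
structure ApproachSystem (X : Type*) where
  /-- the ideal of local distances at a point -/
  sys : X → Set (X → ℝ≥0∞)
  zero_mem : ∀ x, (fun _ => 0) ∈ sys x
  sup_mem : ∀ x, ∀ φ ∈ sys x, ∀ ψ ∈ sys x, φ ⊔ ψ ∈ sys x
  lower : ∀ x, ∀ φ ∈ sys x, ∀ ψ : X → ℝ≥0∞, ψ ≤ φ → ψ ∈ sys x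
  apply_self : ∀ x, ∀ φ ∈ sys x, φ x = 0
  saturated : ∀ x, ∀ φ : X → ℝ≥0∞,
    (∀ ε : ℝ≥0∞, 0 < ε → ∀ ω : ℝ≥0∞, ω ≠ ⊤ →
      ∃ ψ ∈ sys x, ∀ y, min (φ y) ω ≤ ψ y + ε) → φ ∈ sys x
  triangle : ∀ x, ∀ φ ∈ sys x, ∀ ε : ℝ≥0∞, 0 < ε → ∀ ω : ℝ≥0∞, ω ≠ ⊤ →
    ∃ Ψ : X → X → ℝ≥0∞, (∀ z, Ψ z ∈ sys z) ∧
      ∀ y z, min (φ y) ω ≤ Ψ x z + Ψ z y + ε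

namespace ApproachSystem

/-- A map between approach spaces is a contraction iff pulling back local distances at `f x`
yields local distances at `x`. -/
def IsContraction {X Y : Type*} (A : ApproachSystem X) (B : ApproachSystem Y) (f : X → Y) :
    Prop :=
  ∀ x, ∀ ψ ∈ B.sys (f x), ψ ∘ f ∈ A.sys x

/-- The approach structure underlying a (quasi-)metric `d`: the local distances at `x` are the
functions dominated by `d x`. -/
def ofMetric {X : Type*} (d : X → X → ℝ≥0∞) (hself : ∀ x, d x x = 0)
    (htri : ∀ x y z, d x z ≤ d x y + d y z) : ApproachSystem X where
  sys x := {φ | φ ≤ d x}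
  zero_mem _ _ := zero_le
  sup_mem x φ hφ ψ hψ := sup_le (α := X → ℝ≥0∞) (c := d x) hφ hψ
  lower _ _ hφ _ h := h.trans hφ
  apply_self x _ hφ := le_antisymm ((hφ x).trans (hself x).le) zero_le
  saturated x φ h y := by
    refine ENNReal.le_of_forall_pos_le_add fun ε hε hfin => ?_
    obtain ⟨ψ, hψ, hle⟩ := h (min (ε : ℝ≥0∞) 1) (by simpa using hε)
      (d x y + 2) (by simpa using hfin.ne)
    have h1 := (hle y).trans (add_le_add_left (hψ y) _)
    have h2 : d x y + min (ε : ℝ≥0∞) 1 < d x y + 2 := by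
      refine (ENNReal.add_lt_add_iff_left hfin.ne).2 ((min_le_right _ _).trans_lt ?_)
      exact ENNReal.one_lt_two
    rcases min_le_iff.1 h1 with h3 | h3
    · exact h3.trans (add_le_add_right (min_le_left _ _) _)
    · exact absurd h3 (not_le.2 h2)
  triangle x φ hφ ε _ ω _ := ⟨d, fun z => le_refl (d z), fun y z =>
    (min_le_left _ _).trans ((hφ y).trans ((htri x z y).trans le_self_add))⟩

/-- The initial approach structure for a source `(f i : X → Y i)`: the local distances at `x`
are generated, under saturation, by the finite suprema of the functions `ψ ∘ f i` with `ψ` a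
local distance at `f i x`. -/
def initial {ι X : Type*} {Y : ι → Type*} (B : ∀ i, ApproachSystem (Y i)) (f : ∀ i, X → Y i) :
    ApproachSystem X where
  sys x := {φ | ∀ ε : ℝ≥0∞, 0 < ε → ∀ ω : ℝ≥0∞, ω ≠ ⊤ →
    ∃ (K : Finset ι) (ψ : ∀ i, Y i → ℝ≥0∞), (∀ i, ψ i ∈ (B i).sys (f i x)) ∧
      ∀ y, min (φ y) ω ≤ (K.sup fun i => ψ i (f i y)) + ε}
  zero_mem x ε _ ω _ := ⟨∅, fun _ _ => 0, fun i => (B i).zero_mem _, fun y => by simp⟩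
  sup_mem x φ₁ h₁ φ₂ h₂ ε hε ω hω := by
    classical
    obtain ⟨K₁, ψ₁, m₁, l₁⟩ := h₁ ε hε ω hω
    obtain ⟨K₂, ψ₂, m₂, l₂⟩ := h₂ ε hε ω hω
    refine ⟨K₁ ∪ K₂, fun i => ψ₁ i ⊔ ψ₂ i, fun i => (B i).sup_mem _ _ (m₁ i) _ (m₂ i),
      fun y => ?_⟩
    have e : min ((φ₁ ⊔ φ₂) y) ω = max (min (φ₁ y) ω) (min (φ₂ y) ω) := by
      exact inf_sup_right (φ₁ y) (φ₂ y) ω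
    rw [e]
    refine max_le ((l₁ y).trans ?_) ((l₂ y).trans ?_)
    · refine add_le_add_left (Finset.sup_le fun i hi => ?_) _
      exact le_trans (le_max_left (ψ₁ i (f i y)) (ψ₂ i (f i y)))
        (Finset.le_sup (f := fun i => (ψ₁ i ⊔ ψ₂ i) (f i y)) (Finset.mem_union_left _ hi))
    · refine add_le_add_left (Finset.sup_le fun i hi => ?_) _
      exact le_trans (le_max_right (ψ₁ i (f i y)) (ψ₂ i (f i y)))
        (Finset.le_sup (f := fun i => (ψ₁ i ⊔ ψ₂ i) (f i y)) (Finset.mem_union_right _ hi))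
  lower x φ hφ φ' h ε hε ω hω := by
    obtain ⟨K, ψ, m, l⟩ := hφ ε hε ω hω
    exact ⟨K, ψ, m, fun y => (min_le_min_right _ (h y)).trans (l y)⟩
  apply_self x φ hφ := by
    refine le_antisymm (ENNReal.le_of_forall_pos_le_add fun ε hε _ => ?_) zero_le
    obtain ⟨K, ψ, m, l⟩ := hφ (min (ε : ℝ≥0∞) 1) (by simpa using hε) 2 (by simp)
    have h0 : (K.sup fun i => ψ i (f i x)) = 0 :=
      le_antisymm (Finset.sup_le fun i _ => ((B i).apply_self _ _ (m i)).le) zero_le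
    have h1 := l x
    rw [h0] at h1
    rcases min_le_iff.1 h1 with h3 | h3
    · exact h3.trans (add_le_add_right (min_le_left _ _) _)
    · refine absurd h3 (not_le.2 ?_)
      rw [zero_add]
      exact (min_le_right _ _).trans_lt ENNReal.one_lt_two
  saturated x φ h ε hε ω hω := by
    have hε2 : 0 < ε / 2 := ENNReal.half_pos hε.ne'
    obtain ⟨φ', h', l'⟩ := h (ε / 2) hε2 ω hω
    obtain ⟨K, ψ, m, l⟩ := h' (ε / 2) hε2 ω hω
    refine ⟨K, ψ, m, fun y => ?_⟩
    have h1 : min (φ y) ω ≤ min (φ' y) ω + ε / 2 := by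
      rcases le_total (φ' y) ω with h2 | h2
      · rw [min_eq_left h2]
        exact l' y
      · rw [min_eq_right h2]
        exact (min_le_right _ _).trans le_self_add
    calc min (φ y) ω ≤ min (φ' y) ω + ε / 2 := h1
      _ ≤ (K.sup fun i => ψ i (f i y)) + ε / 2 + ε / 2 := add_le_add_left (l y) _
      _ = (K.sup fun i => ψ i (f i y)) + ε := by rw [add_assoc, ENNReal.add_halves]
  triangle x φ hφ ε hε ω hω := by
    have hε2 : 0 < ε / 2 := ENNReal.half_pos hε.ne'
    obtain ⟨K, ψ, m, l⟩ := hφ (ε / 2) hε2 ω hω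
    choose Ψ hΨ hl using fun i => (B i).triangle (f i x) (ψ i) (m i) (ε / 2) hε2 ω hω
    refine ⟨fun z y => K.sup fun i => Ψ i (f i z) (f i y), fun z ε' _ ω' _ =>
      ⟨K, fun i => Ψ i (f i z), fun i => hΨ i _, fun y => (min_le_left _ _).trans le_self_add⟩,
      fun y z => ?_⟩
    have h1 : min (φ y) ω ≤ min (K.sup fun i => ψ i (f i y)) ω + ε / 2 := by
      rcases le_total (K.sup fun i => ψ i (f i y)) ω with h2 | h2
      · rw [min_eq_left h2]
        exact l y
      · rw [min_eq_right h2]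
        exact (min_le_right _ _).trans le_self_add
    have h2 : min (K.sup fun i => ψ i (f i y)) ω ≤
        (K.sup fun i => Ψ i (f i x) (f i z)) + (K.sup fun i => Ψ i (f i z) (f i y)) + ε / 2 := by
      refine (Finset.sup_inf_distrib_right K (fun i => ψ i (f i y)) ω).le.trans ?_
      refine Finset.sup_le fun i hi => (hl i (f i y) (f i z)).trans ?_
      exact add_le_add_left (add_le_add
        (Finset.le_sup (f := fun i => Ψ i (f i x) (f i z)) hi)
        (Finset.le_sup (f := fun i => Ψ i (f i z) (f i y)) hi)) _
    calc min (φ y) ω ≤ min (K.sup fun i => ψ i (f i y)) ω + ε / 2 := h1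
      _ ≤ _ + ε / 2 := add_le_add_left h2 _
      _ = _ := by rw [add_assoc, ENNReal.add_halves]

/-- All maps of the source are contractions for the initial structure. -/
theorem initial_isContraction {ι X : Type*} {Y : ι → Type*} (B : ∀ i, ApproachSystem (Y i))
    (f : ∀ i, X → Y i) (i : ι) : (initial B f).IsContraction (B i) (f i) := by
  classical
  intro x ψ hψ ε _ ω _
  refine ⟨{i}, fun j => if h : i = j then h ▸ ψ else fun _ => 0, fun j => ?_, fun y => ?_⟩
  · by_cases h : i = j
    · subst h
      simpa using hψ
    · simpa [h] using (B j).zero_mem _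
  · simp

/-- The initial structure is the coarsest one for which all maps of the source are
contractions. -/
theorem initial_coarsest {ι X : Type*} {Y : ι → Type*} (B : ∀ i, ApproachSystem (Y i))
    (f : ∀ i, X → Y i) (A : ApproachSystem X) (hA : ∀ i, A.IsContraction (B i) (f i)) (x : X) :
    (initial B f).sys x ⊆ A.sys x := by
  classical
  intro φ hφ
  refine A.saturated x φ fun ε hε ω hω => ?_
  obtain ⟨K, ψ, m, l⟩ := hφ ε hε ω hω
  refine ⟨fun y => K.sup fun i => ψ i (f i y), ?_, l⟩
  clear l
  induction K using Finset.induction_on with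
  | empty => simpa using A.zero_mem x
  | insert i K _ ih =>
    have := A.sup_mem x _ (hA i x (ψ i) (m i)) _ ih
    simpa [Finset.sup_insert, Pi.sup_def, Function.comp_def] using this

variable {X : Type*}

/-- The ball with radius `ε` of a local distance `φ`. -/
def ball (φ : X → ℝ≥0∞) (ε : ℝ≥0∞) : Set X := {y | φ y < ε}

/-- The sequence `a` is `ε`-convergent to `x`: each ball with center `x` and radius `ε` contains
`a n` for all large `n`. -/
def EpsConvergesTo (A : ApproachSystem X) (ε : ℝ≥0∞) (a : ℕ → X) (x : X) : Prop :=
  ∀ φ ∈ A.sys x, ∀ᶠ n in atTop, a n ∈ ball φ ε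

/-- Every sequence in `D` contains a subsequence which is `ε`-convergent to a point of `X`. -/
def IsEpsRelSeqCompact (A : ApproachSystem X) (ε : ℝ≥0∞) (D : Set X) : Prop :=
  ∀ a : ℕ → X, (∀ n, a n ∈ D) →
    ∃ k : ℕ → ℕ, StrictMono k ∧ ∃ x, A.EpsConvergesTo ε (a ∘ k) x

/-- For every choice `Φ` of a local distance at each point of `X`, the set `D` can be covered
with finitely many `Φ`-balls with radius `ε`. -/
def IsEpsRelCompact (A : ApproachSystem X) (ε : ℝ≥0∞) (D : Set X) : Prop :=
  ∀ Φ : X → X → ℝ≥0∞, (∀ x, Φ x ∈ A.sys x) →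
    ∃ t : Finset X, D ⊆ ⋃ x ∈ t, ball (Φ x) ε

/-- The relative sequential compactness index. -/
noncomputable def chiRsc (A : ApproachSystem X) (D : Set X) : ℝ≥0∞ :=
  sInf {α | 0 < α ∧ α ≠ ⊤ ∧ A.IsEpsRelSeqCompact α D}

/-- The relative compactness index. -/
noncomputable def chiRc (A : ApproachSystem X) (D : Set X) : ℝ≥0∞ :=
  sInf {α | 0 < α ∧ α ≠ ⊤ ∧ A.IsEpsRelCompact α D}

end ApproachSystem

/-- Cumulative distribution functions on the real line. -/
structure Cdf extends StieltjesFunction ℝ where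
  tendsto_atBot' : Tendsto toFun atBot (𝓝 0)
  tendsto_atTop' : Tendsto toFun atTop (𝓝 1)

namespace Cdf

instance : CoeFun Cdf fun _ => ℝ → ℝ := ⟨fun F => F.toStieltjesFunction⟩

theorem mono (F : Cdf) : Monotone F := F.toStieltjesFunction.mono

theorem tendsto_atBot (F : Cdf) : Tendsto F atBot (𝓝 0) := F.tendsto_atBot'

theorem tendsto_atTop (F : Cdf) : Tendsto F atTop (𝓝 1) := F.tendsto_atTop'

theorem nonneg (F : Cdf) (x : ℝ) : 0 ≤ F x := F.mono.le_of_tendsto F.tendsto_atBot x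

theorem le_one (F : Cdf) (x : ℝ) : F x ≤ 1 := F.mono.ge_of_tendsto F.tendsto_atTop x

theorem norm_le_one (F : Cdf) (x : ℝ) : ‖F x‖ ≤ 1 := by
  rw [Real.norm_of_nonneg (F.nonneg x)]
  exact F.le_one x

/-- The Lebesgue–Stieltjes probability measure `dF` of a cdf `F`. -/
noncomputable def measure (F : Cdf) : Measure ℝ := F.toStieltjesFunction.measure

instance (F : Cdf) : IsProbabilityMeasure F.measure :=
  F.toStieltjesFunction.isProbabilityMeasure F.tendsto_atBot F.tendsto_atTop

theorem measurable_sub (F : Cdf) (x : ℝ) : Measurable fun y => F (x - y) :=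
  F.mono.measurable.comp (measurable_const.sub measurable_id)

theorem integrable_sub (F G : Cdf) (x : ℝ) : Integrable (fun y => F (x - y)) G.measure :=
  Integrable.of_bound (F.measurable_sub x).aestronglyMeasurable 1
    (Eventually.of_forall fun _ => F.norm_le_one _)

/-- Dominated convergence for the integrals that define the convolution product. -/
theorem tendsto_integral_sub (F G : Cdf) {l : Filter ℝ} [l.IsCountablyGenerated] {c : ℝ → ℝ}
    (h : ∀ᵐ y ∂G.measure, Tendsto (fun x => F (x - y)) l (𝓝 (c y))) :
    Tendsto (fun x => ∫ y, F (x - y) ∂G.measure) l (𝓝 (∫ y, c y ∂G.measure)) :=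
  tendsto_integral_filter_of_dominated_convergence (fun _ => (1 : ℝ))
    (Eventually.of_forall fun x => (F.measurable_sub x).aestronglyMeasurable)
    (Eventually.of_forall fun _ => Eventually.of_forall fun _ => F.norm_le_one _)
    (integrable_const _) h

/-- The convolution product `(F ⋆ G)(x) = ∫ F(x - y) dG(y)`. -/
noncomputable def conv (F G : Cdf) : Cdf where
  toFun x := ∫ y, F (x - y) ∂G.measure
  mono' a b hab := integral_mono (F.integrable_sub G a) (F.integrable_sub G b)
    fun y => F.mono (sub_le_sub_right hab y)
  right_continuous' x := F.tendsto_integral_sub G (Eventually.of_forall fun y =>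
    (F.toStieltjesFunction.right_continuous (x - y)).tendsto.comp
      (tendsto_nhdsWithin_of_tendsto_nhds_of_eventually_within _
        (((continuous_id.sub continuous_const).tendsto x).mono_left nhdsWithin_le_nhds)
        (eventually_nhdsWithin_of_forall fun _ hz => sub_le_sub_right hz y)))
  tendsto_atBot' := by
    simpa using F.tendsto_integral_sub G (c := fun _ => 0) (Eventually.of_forall fun y =>
      F.tendsto_atBot.comp (tendsto_atBot_add_const_right _ (-y) tendsto_id))
  tendsto_atTop' := by
    simpa using F.tendsto_integral_sub G (c := fun _ => 1) (Eventually.of_forall fun y =>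
      F.tendsto_atTop.comp (tendsto_atTop_add_const_right _ (-y) tendsto_id))

/-- `F ⋆ G` is continuous if `G` is. -/
theorem continuous_conv (F G : Cdf) (hG : Continuous G) : Continuous (F.conv G) := by
  refine continuous_iff_continuousAt.2 fun x => F.tendsto_integral_sub G ?_
  have : NullSingletonClass G.measure := ⟨fun a => by
    have h : Function.leftLim G.toStieltjesFunction a = G a :=
      (hG.continuousAt (x := a)).continuousWithinAt.leftLim_eq
    rw [measure, StieltjesFunction.measure_singleton, h, sub_self, ENNReal.ofReal_zero]⟩
  have hc : {y | ¬ ContinuousAt F (x - y)}.Countable :=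
    F.mono.countable_not_continuousAt.preimage (sub_right_injective (b := x))
  filter_upwards [hc.ae_notMem G.measure] with y hy
  have hy' : ContinuousAt F (x - y) := not_not.1 hy
  exact hy'.tendsto.comp ((continuous_id.sub continuous_const).tendsto x)

/-- The weak topology: the initial topology for the maps `F ↦ ∫ h dF`, with `h` running through
the bounded continuous functions. -/
noncomputable instance weakTopology : TopologicalSpace Cdf :=
  ⨅ h : ℝ →ᵇ ℝ, TopologicalSpace.induced (fun F : Cdf => ∫ x, h x ∂F.measure) inferInstance

/-- Each sequence in `D` contains a weakly convergent subsequence (the limit being a cdf, not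
necessarily in `D`). -/
def IsWeaklyRelSeqCompact (D : Set Cdf) : Prop :=
  ∀ a : ℕ → Cdf, (∀ n, a n ∈ D) →
    ∃ k : ℕ → ℕ, StrictMono k ∧ ∃ F : Cdf, Tendsto (a ∘ k) atTop (𝓝 F)

end Cdf

/-- Continuous cumulative distribution functions. -/
def ContCdf : Type := {F : Cdf // Continuous F}

namespace ContCdf

/-- The uniform distance `sup_x |F x - G x|`. -/
noncomputable def uniformDist (F G : ContCdf) : ℝ≥0∞ :=
  ⨆ x : ℝ, ENNReal.ofReal |F.1 x - G.1 x|

/-- The approach structure underlying the uniform distance. -/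
noncomputable def uniformApproach : ApproachSystem ContCdf :=
  ApproachSystem.ofMetric uniformDist (fun F => by simp [uniformDist]) fun F G H =>
    iSup_le fun x =>
      calc ENNReal.ofReal |F.1 x - H.1 x|
          ≤ ENNReal.ofReal (|F.1 x - G.1 x| + |G.1 x - H.1 x|) :=
            ENNReal.ofReal_le_ofReal (abs_sub_le _ _ _)
        _ ≤ ENNReal.ofReal |F.1 x - G.1 x| + ENNReal.ofReal |G.1 x - H.1 x| :=
            ENNReal.ofReal_add_le
        _ ≤ uniformDist F G + uniformDist G H :=
            add_le_add (le_iSup (fun x => ENNReal.ofReal |F.1 x - G.1 x|) x)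
              (le_iSup (fun x => ENNReal.ofReal |G.1 x - H.1 x|) x)

end ContCdf

/-- The continuity approach structure on the set of cdfs: the initial approach structure for the
source of all maps `F ↦ F ⋆ G` into the continuous cdfs with the uniform distance, with `G`
running through the continuous cdfs. -/
noncomputable def continuityApproach : ApproachSystem Cdf :=
  ApproachSystem.initial (fun _ : ContCdf => ContCdf.uniformApproach)
    fun G F => ⟨F.conv G.1, F.continuous_conv G.1 G.2⟩

/-! Both indices equal the asymptotic tail mass of `D`: the infimum of the `m` for which one
interval `[-M, M]` leaves mass at most `m` in each tail, for all members of `D` at once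
(`IsTailBound`). The link between local distances and tails is `LevyClose`, a Lévy-type
neighbourhood with separate horizontal and vertical tolerances.

Compactness bounds the tails. Smoothing with the uniform law on `[0, 1]` gives one explicit local
distance at each `F`, and its `α`-ball lies in the Lévy neighbourhood with tolerances `1` and `α`
(`levyClose_of_smoothDist_lt`). A fixed horizontal shift is harmless far out, so all members of the
ball have tails at most `β`, for any `β > α`, beyond an `M` depending only on `F`.

Conversely, suppose the tails are bounded by `m + ε` for every `ε > 0`. Along an ultrafilter
containing `D`, cdfs converge pointwise to a monotone function that may lose mass up to `m` at each
end. Putting the lost mass at `0` yields a cdf `F` within `m` of the right-continuous version, and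
the ultrafilter eventually enters each Lévy neighbourhood of `F` with tolerances `δ` and `m + δ`
(`exists_levyClose_of_isTailBound`). Local distances at `F` are below any given `c > m` on such a
neighbourhood for small `δ`, because each `F ⋆ G` is uniformly continuous (`exists_levyClose_lt`).
Both kinds of compactness follow.

The index vanishes exactly when `D` is tight, and the case `m = 0` of the same selection argument
gives weak limits. -/

/-- If `P` at a radius implies `Q` at every larger finite radius, then the infimal radius for `Q`
is at most the one for `P`. -/
theorem sInf_le_sInf_of_forall_lt {P Q : ℝ≥0∞ → Prop}
    (h : ∀ a b, 0 < a → a < b → b ≠ ⊤ → P a → Q b) :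
    sInf {α | 0 < α ∧ α ≠ ⊤ ∧ Q α} ≤ sInf {α | 0 < α ∧ α ≠ ⊤ ∧ P α} := by
  refine le_sInf fun a ⟨h0, htop, ha⟩ => ENNReal.le_of_forall_pos_le_add fun ε hε _ => ?_
  have hlt : a < a + ε := ENNReal.lt_add_right htop (by simpa using hε.ne')
  exact sInf_le ⟨h0.trans hlt, by finiteness, h a _ h0 hlt (by finiteness) ha⟩

/-! ### Lévy neighbourhoods and local distances -/

namespace Cdf

theorem integral_shift_sub (F G : Cdf) (x c : ℝ) :
    ∫ y, (F (x - y) + c) ∂G.measure = F.conv G x + c := by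
  rw [integral_add (F.integrable_sub G x) (integrable_const _)]
  simp [conv]

/-- `H` lies in the closed Lévy-type neighbourhood of `F` with horizontal tolerance `δ` and vertical
tolerance `η`. -/
def LevyClose (F : Cdf) (δ η : ℝ) (H : Cdf) : Prop :=
  ∀ x, F (x - δ) - η ≤ H x ∧ H x ≤ F (x + δ) + η

theorem LevyClose.mono {F H : Cdf} {δ δ' η η' : ℝ} (h : F.LevyClose δ η H) (hδ : δ ≤ δ')
    (hη : η ≤ η') : F.LevyClose δ' η' H := fun x =>
  ⟨(sub_le_sub (F.mono (by linarith)) hη).trans (h x).1,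
    (h x).2.trans (add_le_add (F.mono (by linarith)) hη)⟩

/-- Convolution averages translates, and the defining inequalities are translation invariant:
integrate them at `x - y` against `G`. The tolerances do not depend on `G`. -/
theorem LevyClose.conv {F H : Cdf} {δ η : ℝ} (h : F.LevyClose δ η H) (G : Cdf) :
    (F.conv G).LevyClose δ η (H.conv G) := by
  intro x
  constructor
  · rw [sub_eq_add_neg, ← integral_shift_sub]
    refine integral_mono ((F.integrable_sub G _).add (integrable_const _))
      (H.integrable_sub G x) fun y => ?_
    have := (h (x - y)).1
    rwa [sub_right_comm, sub_eq_add_neg] at this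
  · rw [← integral_shift_sub]
    refine integral_mono (H.integrable_sub G x)
      ((F.integrable_sub G _).add (integrable_const _)) fun y => ?_
    have := (h (x - y)).2
    rwa [sub_add_eq_add_sub] at this

/-- Continuous cdfs are uniformly continuous. -/
theorem uniformContinuous_of_continuous (F : Cdf) (hF : Continuous F) : UniformContinuous F := by
  rw [Metric.uniformContinuous_iff]
  intro ε hε
  obtain ⟨A, hA⟩ := (F.tendsto_atBot.eventually (gt_mem_nhds hε)).exists_forall_of_atBot
  obtain ⟨B, hB⟩ := (F.tendsto_atTop.eventually
    (lt_mem_nhds (show 1 - ε < 1 by linarith))).exists_forall_of_atTop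
  -- The margin of 1 on each side ensures that two points at distance below 1, not both in this
  -- interval, lie in a common tail.
  have hK : UniformContinuousOn F (Icc (A - 1) (B + 1)) :=
    isCompact_Icc.uniformContinuousOn_of_continuous hF.continuousOn
  obtain ⟨δ, hδ, h⟩ := Metric.uniformContinuousOn_iff.1 hK ε hε
  refine ⟨min δ 1, lt_min hδ one_pos, fun {x y} hxy => ?_⟩
  have h1 : |x - y| < 1 := hxy.trans_le (min_le_right _ _)
  rw [abs_lt] at h1
  have b1 := F.nonneg x
  have b2 := F.nonneg y
  have b3 := F.le_one x
  have b4 := F.le_one y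
  rw [Real.dist_eq, abs_lt]
  by_cases hx : x ∈ Icc (A - 1) (B + 1) ∧ y ∈ Icc (A - 1) (B + 1)
  · have := h x hx.1 y hx.2 (hxy.trans_le (min_le_left _ _))
    rwa [Real.dist_eq, abs_lt] at this
  · by_cases hl : x ≤ A ∧ y ≤ A
    · have := hA x hl.1
      have := hA y hl.2
      constructor <;> linarith
    · by_cases hr : B ≤ x ∧ B ≤ y
      · have := hB x hr.1
        have := hB y hr.2
        constructor <;> linarith
      · exfalso
        simp only [mem_Icc] at hx
        grind

/-- Local distances of the continuity approach structure are small on small Lévy neighbourhoods. -/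
theorem exists_levyClose_lt {F : Cdf} {φ : Cdf → ℝ≥0∞} (hφ : φ ∈ continuityApproach.sys F)
    {m c : ℝ} (hm : 0 ≤ m) (hmc : m < c) :
    ∃ δ > 0, ∀ H, F.LevyClose δ (m + δ) H → φ H < ENNReal.ofReal c := by
  -- Of the four quarters of `c - m`, one pays for `d`, one for the oscillation of `F ⋆ G`, one for
  -- the saturation error, and one keeps the inequality strict.
  set ε := (c - m) / 4 with hε
  have hε0 : 0 < ε := by simp only [hε]; linarith
  obtain ⟨K, ψ, hψ, hle⟩ := hφ (ENNReal.ofReal ε) (by simpa using hε0) (ENNReal.ofReal c)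
    ENNReal.ofReal_ne_top
  have hG : ∀ G : ContCdf, ∃ δ > 0, δ ≤ ε ∧ ∀ x,
      F.conv G.1 (x + δ) ≤ F.conv G.1 x + ε ∧ F.conv G.1 x - ε ≤ F.conv G.1 (x - δ) := by
    intro G
    obtain ⟨δ, hδ, h⟩ := Metric.uniformContinuous_iff.1
      (uniformContinuous_of_continuous _ (F.continuous_conv G.1 G.2)) ε hε0
    have hp : 0 < min (δ / 2) ε := lt_min (by linarith) hε0
    have hlt : min (δ / 2) ε < δ := (min_le_left _ _).trans_lt (by linarith)
    refine ⟨min (δ / 2) ε, hp, min_le_right _ _, fun x => ?_⟩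
    have h1 := @h (x + min (δ / 2) ε) x (by simpa [Real.dist_eq, abs_of_pos hp] using hlt)
    have h2 := @h (x - min (δ / 2) ε) x (by simpa [Real.dist_eq, abs_of_pos hp] using hlt)
    rw [Real.dist_eq, abs_lt] at h1 h2
    constructor <;> linarith
  choose δ hδ hδε hδ' using hG
  obtain ⟨d, hd, hdle⟩ : ∃ d > 0, d ≤ ε ∧ ∀ G ∈ K, d ≤ δ G := by
    rcases K.eq_empty_or_nonempty with rfl | hK
    · exact ⟨ε, hε0, le_rfl, by simp⟩
    · refine ⟨min ε (K.inf' hK δ), lt_min hε0 ((Finset.lt_inf'_iff hK).2 fun G _ => hδ G),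
        min_le_left _ _, fun G hG => (min_le_right _ _).trans (Finset.inf'_le _ hG)⟩
  refine ⟨d, hd, fun H hH => ?_⟩
  have hsup : (K.sup fun G => ψ G ⟨H.conv G.1, H.continuous_conv G.1 G.2⟩) ≤
      ENNReal.ofReal (m + 2 * ε) := by
    refine Finset.sup_le fun G hG => (hψ G _).trans (iSup_le fun x => ENNReal.ofReal_le_ofReal ?_)
    have h1 := ((hH.mono (hdle.2 G hG) le_rfl).conv G.1) x
    have h2 := hδ' G x
    have := hdle.1
    rw [abs_le]
    constructor <;> linarith [h1.1, h1.2, h2.1, h2.2]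
  have h2 : min (φ H) (ENNReal.ofReal c) < ENNReal.ofReal c := by
    refine ((hle H).trans (add_le_add_left hsup _)).trans_lt ?_
    rw [← ENNReal.ofReal_add (by linarith) hε0.le]
    exact (ENNReal.ofReal_lt_ofReal_iff (by linarith)).2 (by simp only [hε]; linarith)
  -- The truncation level is `c` itself, so a truncated value below `c` is the true value.
  simpa using h2

/-! ### Smoothing with the uniform distribution -/

/-- The cdf of the uniform distribution on `[0, 1]`. -/
noncomputable def uniformUnit : Cdf where
  toFun x := max 0 (min 1 x)
  mono' _ _ h := max_le_max le_rfl (min_le_min le_rfl h)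
  right_continuous' x := (by fun_prop : Continuous fun x : ℝ => max 0 (min 1 x)).continuousWithinAt
  tendsto_atBot' := tendsto_const_nhds.congr' ((eventually_le_atBot 0).mono fun x hx => by
    simp [min_eq_right (hx.trans zero_le_one), max_eq_left hx])
  tendsto_atTop' := tendsto_const_nhds.congr' ((eventually_ge_atTop 1).mono fun x hx => by
    simp [min_eq_left hx])

theorem continuous_uniformUnit : Continuous uniformUnit :=
  (by fun_prop : Continuous fun x : ℝ => max 0 (min 1 x))

theorem ae_mem_uniformUnit : ∀ᵐ y ∂uniformUnit.measure, y ∈ Ioc (0 : ℝ) 1 := by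
  have h : uniformUnit.measure (Ioc 0 1) = 1 := by
    rw [measure, StieltjesFunction.measure_Ioc]
    simp [uniformUnit]
  exact (prob_compl_eq_zero_iff measurableSet_Ioc).2 h

theorem conv_uniformUnit_le (H : Cdf) (x : ℝ) : H.conv uniformUnit x ≤ H x := by
  have : H.conv uniformUnit x ≤ ∫ _, H x ∂uniformUnit.measure :=
    integral_mono_ae (H.integrable_sub _ x) (integrable_const _)
      (ae_mem_uniformUnit.mono fun y hy => H.mono (by linarith [hy.1]))
  simpa using this

theorem le_conv_uniformUnit (H : Cdf) (x : ℝ) : H (x - 1) ≤ H.conv uniformUnit x := by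
  have : ∫ _, H (x - 1) ∂uniformUnit.measure ≤ H.conv uniformUnit x :=
    integral_mono_ae (integrable_const _) (H.integrable_sub _ x)
      (ae_mem_uniformUnit.mono fun y hy => H.mono (by linarith [hy.2]))
  simpa using this

/-- The smoothing of a cdf with the uniform distribution. -/
noncomputable def smooth (F : Cdf) : ContCdf :=
  ⟨F.conv uniformUnit, F.continuous_conv _ continuous_uniformUnit⟩

/-- The uniform distance of the smoothings of `F` and `H` with the uniform distribution. -/
noncomputable def smoothDist (F H : Cdf) : ℝ≥0∞ :=
  ContCdf.uniformDist F.smooth H.smooth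

theorem smooth_isContraction :
    continuityApproach.IsContraction ContCdf.uniformApproach smooth := by
  have h := @ApproachSystem.initial_isContraction ContCdf Cdf (fun _ => ContCdf)
    (fun _ => ContCdf.uniformApproach) (fun G F => ⟨F.conv G.1, F.continuous_conv G.1 G.2⟩)
    ⟨uniformUnit, continuous_uniformUnit⟩
  exact h

/-- Supplies the one explicit local distance at each point to which both compactness hypotheses are
applied. -/
theorem smoothDist_mem (F : Cdf) : smoothDist F ∈ continuityApproach.sys F :=
  smooth_isContraction F (ContCdf.uniformDist F.smooth) fun _ => le_rfl

/-- The smoothed value at `x` lies between the values of the cdf at `x - 1` and `x`, so undoing the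
smoothing costs a horizontal shift of 1 and nothing vertically. -/
theorem levyClose_of_smoothDist_lt {F H : Cdf} {α : ℝ≥0∞} (hα : α ≠ ⊤) (h : smoothDist F H < α) :
    F.LevyClose 1 α.toReal H := by
  have key : ∀ x, |F.conv uniformUnit x - H.conv uniformUnit x| ≤ α.toReal := fun x =>
    (ENNReal.ofReal_le_iff_le_toReal hα).1
      ((le_iSup (fun x => ENNReal.ofReal |F.conv uniformUnit x - H.conv uniformUnit x|) x).trans
        h.le)
  intro x
  constructor
  · have := abs_le.1 (key x)
    linarith [F.le_conv_uniformUnit x, H.conv_uniformUnit_le x]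
  · have := abs_le.1 (key (x + 1))
    have h1 := H.le_conv_uniformUnit (x + 1)
    rw [add_sub_cancel_right] at h1
    linarith [F.conv_uniformUnit_le (x + 1)]

/-! ### Tail bounds from compactness -/

/-- All cdfs in `D` leave at most mass `m` in each of the two tails outside a common interval. -/
def IsTailBound (D : Set Cdf) (m : ℝ) : Prop :=
  ∃ M : ℝ, ∀ H ∈ D, H (-M) ≤ m ∧ 1 - m ≤ H M

/-- A bounded horizontal shift disappears in the limits of `F` at `±∞`, leaving only `η`. The
threshold for `M` depends on `F` alone, which makes the bound uniform in `H`. -/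
theorem LevyClose.eventually_tail (F : Cdf) {δ η β : ℝ} (hβ : η < β) :
    ∀ᶠ M in atTop, ∀ H : Cdf, F.LevyClose δ η H → H (-M) ≤ β ∧ 1 - β ≤ H M := by
  have hb : Tendsto (fun M => F (-M + δ)) atTop (𝓝 0) :=
    F.tendsto_atBot.comp (tendsto_atBot_add_const_right _ _ tendsto_neg_atTop_atBot)
  have ht : Tendsto (fun M => F (M - δ)) atTop (𝓝 1) :=
    F.tendsto_atTop.comp (tendsto_atTop_add_const_right _ _ tendsto_id)
  filter_upwards [hb.eventually (gt_mem_nhds (sub_pos.2 hβ)),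
    ht.eventually (lt_mem_nhds (show 1 - (β - η) < 1 by linarith))] with M h1 h2 H hH
  constructor
  · linarith [(hH (-M)).2]
  · linarith [(hH M).1]

theorem isTailBound_of_isEpsRelCompact {D : Set Cdf} {α : ℝ≥0∞} (hα : α ≠ ⊤)
    (h : continuityApproach.IsEpsRelCompact α D) {β : ℝ} (hβ : α.toReal < β) :
    IsTailBound D β := by
  obtain ⟨t, ht⟩ := h smoothDist smoothDist_mem
  obtain ⟨M, hM⟩ := ((eventually_all_finset t).2 fun F _ =>
    LevyClose.eventually_tail F (δ := 1) hβ).exists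
  refine ⟨M, fun H hH => ?_⟩
  obtain ⟨F, hF, hFH⟩ := mem_iUnion₂.1 (ht hH)
  exact hM F hF H (levyClose_of_smoothDist_lt hα hFH)

/-- If no `M` works, choose `a n` violating the bound at `M = n`. A subsequence with a common `M`
contradicts this once `k n ≥ M`, since the tail conditions weaken as the interval grows. -/
theorem isTailBound_of_seq {D : Set Cdf} {β : ℝ}
    (h : ∀ a : ℕ → Cdf, (∀ n, a n ∈ D) → ∃ k : ℕ → ℕ, StrictMono k ∧
      ∃ M : ℝ, ∀ᶠ n in atTop, a (k n) (-M) ≤ β ∧ 1 - β ≤ a (k n) M) :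
    IsTailBound D β := by
  by_contra hD
  simp only [IsTailBound, not_exists, not_forall] at hD
  choose a ha hna using fun n : ℕ => hD n
  obtain ⟨k, hk, M, hM⟩ := h a ha
  obtain ⟨n, h1, h2⟩ := (hM.and
    ((tendsto_natCast_atTop_atTop.comp hk.tendsto_atTop).eventually_ge_atTop M)).exists
  refine hna (k n) ⟨((a (k n)).mono (neg_le_neg h2)).trans h1.1, h1.2.trans ((a (k n)).mono h2)⟩

theorem isTailBound_of_isEpsRelSeqCompact {D : Set Cdf} {α : ℝ≥0∞} (hα : α ≠ ⊤)
    (h : continuityApproach.IsEpsRelSeqCompact α D) {β : ℝ} (hβ : α.toReal < β) :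
    IsTailBound D β := by
  refine isTailBound_of_seq fun a ha => ?_
  obtain ⟨k, hk, F, hF⟩ := h a ha
  obtain ⟨M, hM⟩ := (LevyClose.eventually_tail F (δ := 1) hβ).exists
  exact ⟨k, hk, M, (hF _ (smoothDist_mem F)).mono fun n hn =>
    hM _ (levyClose_of_smoothDist_lt hα hn)⟩

end Cdf

/-! ### Helly selection with loss of mass -/

namespace Cdf

theorem IsTailBound.mono {D : Set Cdf} {m m' : ℝ} (h : IsTailBound D m) (hm : m ≤ m') :
    IsTailBound D m' :=
  h.imp fun _ hM H hH => ⟨(hM H hH).1.trans hm, by linarith [(hM H hH).2]⟩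

/-- The pointwise limit of an ultrafilter on cdfs is a monotone function with values in `[0, 1]`. -/
theorem exists_monotone_tendsto (U : Ultrafilter Cdf) :
    ∃ h : ℝ → ℝ, Monotone h ∧ (∀ x, h x ∈ Icc (0 : ℝ) 1) ∧
      ∀ x, Tendsto (fun K : Cdf => K x) U (𝓝 (h x)) := by
  have key : ∀ x : ℝ, ∃ y ∈ Icc (0 : ℝ) 1, Tendsto (fun K : Cdf => K x) U (𝓝 y) := fun x =>
    isCompact_Icc.ultrafilter_le_nhds' (U.map fun K : Cdf => K x)
      (Ultrafilter.mem_map.2 (Eventually.of_forall fun K : Cdf => ⟨K.nonneg x, K.le_one x⟩))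
  choose h hI hlim using key
  exact ⟨h, fun x y hxy => le_of_tendsto_of_tendsto' (hlim x) (hlim y) fun K => K.mono hxy, hI,
    hlim⟩

/-- A subdistribution function whose defects at `-∞` and `∞` are at most `m` is uniformly within
distance `m` of a cdf: the missing mass is placed at `0`. -/
theorem exists_abs_sub_le (f : StieltjesFunction ℝ) {m : ℝ} (h0 : ∀ x, 0 ≤ f x)
    (h1 : ∀ x, f x ≤ 1) (hbot : ∀ ε > 0, ∃ x, f x ≤ m + ε) (htop : ∀ ε > 0, ∃ x, 1 - m - ε ≤ f x) :
    ∃ F : Cdf, ∀ x, |F x - f x| ≤ m := by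
  have bb : BddBelow (range f) := ⟨0, forall_mem_range.2 h0⟩
  have ba : BddAbove (range f) := ⟨1, forall_mem_range.2 h1⟩
  have lb := tendsto_atBot_ciInf f.mono bb
  have lt := tendsto_atTop_ciSup f.mono ba
  set a := ⨅ x, f x
  set s := ⨆ x, f x
  have ha0 : 0 ≤ a := le_ciInf h0
  have hs1 : s ≤ 1 := ciSup_le h1
  have ham : a ≤ m := le_of_forall_pos_le_add fun ε hε =>
    let ⟨x, hx⟩ := hbot ε hε
    (ciInf_le bb x).trans hx
  have hsm : 1 - m ≤ s := le_of_forall_sub_le fun ε hε =>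
    let ⟨x, hx⟩ := htop ε hε
    hx.trans (le_ciSup ba x)
  -- The mass `a` lost at `-∞` and the mass `1 - s` lost at `∞` both become an additional jump at
  -- `0`. The deviation from `f` is `a` to the left of `0` and `1 - s` from `0` on, each at most
  -- `m`.
  refine ⟨{ toFun := fun x => if x < 0 then f x - a else f x + (1 - s)
            mono' := fun x y hxy => ?_
            right_continuous' := fun x => ?_
            tendsto_atBot' := ?_
            tendsto_atTop' := ?_ }, fun x => ?_⟩
  · have := f.mono hxy
    dsimp only
    split_ifs <;> linarith
  · rcases lt_or_ge x 0 with hx | hx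
    · refine ((f.right_continuous x).sub continuousWithinAt_const).congr_of_eventuallyEq
        (eventually_nhdsWithin_of_eventually_nhds ((gt_mem_nhds hx).mono fun y hy => if_pos hy))
        (if_pos hx)
    · exact ((f.right_continuous x).add continuousWithinAt_const).congr
        (fun y (hy : x ≤ y) => if_neg (not_lt.2 (hx.trans hy))) (if_neg (not_lt.2 hx))
  · have := lb.sub_const a
    rw [sub_self] at this
    exact this.congr' ((eventually_lt_atBot 0).mono fun x hx => (if_pos hx).symm)
  · have := lt.add_const (1 - s)
    rw [add_sub_cancel] at this
    exact this.congr' ((eventually_ge_atTop 0).mono fun x hx => (if_neg (not_lt.2 hx)).symm)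
  · change |(if x < 0 then f x - a else f x + (1 - s)) - f x| ≤ m
    rw [abs_le]
    split_ifs <;> constructor <;> linarith

/-- Pointwise convergence along a filter to a monotone function that stays, up to right limits,
within `m` of a cdf `F` forces the filter into all Lévy neighbourhoods of `F` of height above `m`. -/
theorem eventually_levyClose {l : Filter Cdf} {h : ℝ → ℝ}
    (hlim : ∀ x, Tendsto (fun K : Cdf => K x) l (𝓝 (h x))) {F : Cdf} {m : ℝ}
    (hup : ∀ x, h x ≤ F x + m) (hlow : ∀ x y, x < y → F x - m ≤ h y) {δ : ℝ} (hδ : 0 < δ) :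
    ∀ᶠ K in l, F.LevyClose δ (m + δ) K := by
  have hub : ∀ x, ∀ ε > 0, ∀ᶠ K : Cdf in l, K x ≤ F x + m + ε := fun x ε hε =>
    ((hlim x).eventually (gt_mem_nhds (show h x < F x + m + ε by linarith [hup x]))).mono
      fun _ => le_of_lt
  have hlb : ∀ x y, x < y → ∀ ε > 0, ∀ᶠ K : Cdf in l, F x - m - ε ≤ K y := fun x y hxy ε hε =>
    ((hlim y).eventually (lt_mem_nhds (show F x - m - ε < h y by linarith [hlow x y hxy]))).mono
      fun _ => le_of_lt
  obtain ⟨A, hA⟩ := (F.tendsto_atBot.eventually (gt_mem_nhds (half_pos hδ))).exists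
  obtain ⟨B, hB⟩ := (F.tendsto_atTop.eventually
    (lt_mem_nhds (show 1 - δ / 2 < 1 by linarith))).exists
  -- Compactness turns pointwise bounds into a uniform one: near each `y`, monotonicity lets the
  -- values of `K` at `y ± δ / 2` control all points within `δ / 4` of `y`. The point `y - 3 * δ /
  -- 4` leaves room for the strict inequality in `hlow`.
  have hmid : ∀ᶠ p : Cdf × ℝ in l ×ˢ 𝓝ˢ (Icc A (B + 1)),
      F (p.2 - δ) - (m + δ) ≤ p.1 p.2 ∧ p.1 p.2 ≤ F (p.2 + δ) + (m + δ) := by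
    refine isCompact_Icc.mem_prod_nhdsSet_of_forall fun y _ => ?_
    filter_upwards [((hub (y + δ / 2) δ hδ).and
      (hlb (y - 3 * δ / 4) (y - δ / 2) (by linarith) δ hδ)).prod_mk
      (Ioo_mem_nhds (show y - δ / 4 < y by linarith) (show y < y + δ / 4 by linarith))]
      with p ⟨⟨h1, h2⟩, h3, h4⟩
    have e1 := p.1.mono (show p.2 ≤ y + δ / 2 by linarith)
    have e2 := p.1.mono (show y - δ / 2 ≤ p.2 by linarith)
    have e3 := F.mono (show y + δ / 2 ≤ p.2 + δ by linarith)
    have e4 := F.mono (show p.2 - δ ≤ y - 3 * δ / 4 by linarith)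
    constructor <;> linarith
  have hmid' : ∀ᶠ K : Cdf in l, ∀ x ∈ Icc A (B + 1),
      F (x - δ) - (m + δ) ≤ K x ∧ K x ≤ F (x + δ) + (m + δ) :=
    hmid.curry.mono fun K hK x hx => hK.self_of_nhdsSet x hx
  filter_upwards [hmid', hub A (δ / 2) (half_pos hδ), hlb B (B + 1) (lt_add_one B) (δ / 2)
    (half_pos hδ)] with K hK h1 h2 x
  -- Nonnegativity is implied by `hup` and `hlow` near `∞`. It is needed in the tails, where one of
  -- the two bounds only compares with `0` or `1`.
  have hm : 0 ≤ m := by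
    refine le_of_forall_pos_le_add fun ε hε => ?_
    obtain ⟨y, hy⟩ := (F.tendsto_atTop.eventually (lt_mem_nhds
      (show 1 - ε < 1 by linarith))).exists
    have := hlow y (y + 1) (by linarith)
    have := hup (y + 1)
    have := F.le_one (y + 1)
    linarith
  by_cases hx : x ∈ Icc A (B + 1)
  · exact hK x hx
  · rcases lt_or_ge x A with hxA | hxA
    · have e1 := K.mono hxA.le
      have e2 := F.mono (show x - δ ≤ A by linarith)
      constructor <;> linarith [K.nonneg x, F.nonneg (x + δ)]
    · have hxB : B + 1 ≤ x := by
        by_contra hlt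
        exact hx ⟨hxA, (not_le.1 hlt).le⟩
      have e1 := K.mono hxB
      have e2 := F.mono (show B ≤ x + δ by linarith)
      constructor <;> linarith [K.le_one x, F.le_one (x - δ)]

theorem exists_levyClose_of_isTailBound (U : Ultrafilter Cdf) {D : Set Cdf} (hD : D ∈ U) {m : ℝ}
    (hT : ∀ ε > 0, IsTailBound D (m + ε)) :
    ∃ F : Cdf, ∀ δ > 0, ∀ᶠ K in (U : Filter Cdf), F.LevyClose δ (m + δ) K := by
  obtain ⟨h, hmono, hI, hlim⟩ := exists_monotone_tendsto U
  -- The pointwise limit need not be right-continuous; these two inequalities are all that is needed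
  -- to pass between it and its right limits.
  have hle : ∀ x, h x ≤ hmono.stieltjesFunction x := fun x => hmono.le_rightLim le_rfl
  have hge : ∀ x y, x < y → hmono.stieltjesFunction x ≤ h y := fun x y => hmono.rightLim_le
  obtain ⟨F, hF⟩ := exists_abs_sub_le (m := m) hmono.stieltjesFunction
    (fun x => (hI x).1.trans (hle x))
    (fun x => (hge x (x + 1) (lt_add_one x)).trans (hI _).2) (fun ε hε => by
      obtain ⟨M, hM⟩ := hT ε hε
      refine ⟨-M - 1, (hge _ (-M) (by linarith)).trans ?_⟩
      exact le_of_tendsto (hlim _) (mem_of_superset hD fun K hK => (hM K hK).1)) (fun ε hε => by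
      obtain ⟨M, hM⟩ := hT ε hε
      refine ⟨M, le_trans ?_ (hle M)⟩
      rw [sub_sub]
      exact ge_of_tendsto (hlim _) (mem_of_superset hD fun K hK => (hM K hK).2))
  refine ⟨F, fun δ hδ => eventually_levyClose hlim (fun x => ?_) (fun x y hxy => ?_) hδ⟩
  · linarith [(abs_le.1 (hF x)).1, hle x]
  · linarith [(abs_le.1 (hF x)).2, hge x y hxy]

/-- A quantitative Helly selection theorem. -/
theorem exists_subseq_levyClose {D : Set Cdf} {m : ℝ} (hT : ∀ ε > 0, IsTailBound D (m + ε))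
    (a : ℕ → Cdf) (ha : ∀ n, a n ∈ D) :
    ∃ k : ℕ → ℕ, StrictMono k ∧ ∃ F : Cdf, ∀ δ > 0, ∀ᶠ n in atTop,
      F.LevyClose δ (m + δ) (a (k n)) := by
  -- A free ultrafilter on the indices replaces the usual diagonal selection. Its members are
  -- infinite, so the sequence visits the neighbourhood with tolerances `1 / (n + 1)` and `m + 1 /
  -- (n + 1)` infinitely often for each `n`.
  obtain ⟨F, hF⟩ := exists_levyClose_of_isTailBound ((hyperfilter ℕ).map a)
    (Ultrafilter.mem_map.2 (Eventually.of_forall ha)) hT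
  have hfreq : ∀ n : ℕ, ∃ᶠ j in atTop, F.LevyClose (1 / (n + 1)) (m + 1 / (n + 1)) (a j) :=
    fun n => Frequently.filter_mono
      (Eventually.frequently (hF (1 / (n + 1)) (by positivity))) Nat.hyperfilter_le_atTop
  obtain ⟨k, hk, h⟩ := extraction_forall_of_frequently hfreq
  refine ⟨k, hk, F, fun δ hδ => ?_⟩
  filter_upwards [tendsto_one_div_add_atTop_nhds_zero_nat.eventually (gt_mem_nhds hδ)] with n hn
  exact (h n).mono hn.le (by linarith)

/-! ### Compactness from tail bounds -/

theorem isEpsRelSeqCompact_of_isTailBound {D : Set Cdf} {m : ℝ} (hm : 0 ≤ m)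
    (hT : ∀ ε > 0, IsTailBound D (m + ε)) {α : ℝ≥0∞} (hα : α ≠ ⊤) (hmα : m < α.toReal) :
    continuityApproach.IsEpsRelSeqCompact α D := by
  intro a ha
  obtain ⟨k, hk, F, hF⟩ := exists_subseq_levyClose hT a ha
  refine ⟨k, hk, F, fun φ hφ => ?_⟩
  obtain ⟨δ, hδ, h⟩ := exists_levyClose_lt hφ hm hmα
  rw [ENNReal.ofReal_toReal hα] at h
  exact (hF δ hδ).mono fun n hn => h _ hn

theorem isEpsRelCompact_of_isTailBound {D : Set Cdf} {m : ℝ} (hm : 0 ≤ m)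
    (hT : ∀ ε > 0, IsTailBound D (m + ε)) {α : ℝ≥0∞} (hα : α ≠ ⊤) (hmα : m < α.toReal) :
    continuityApproach.IsEpsRelCompact α D := by
  classical
  intro Φ hΦ
  by_contra! hcov
  -- Without a finite cover, the uncovered parts of `D` generate a proper filter. An ultrafilter
  -- refining it must enter the ball around its own generalized limit `F`, yet contains the
  -- complement of that ball through `s {F}`.
  let s : Finset Cdf → Set Cdf := fun t => D \ ⋃ x ∈ t, ApproachSystem.ball (Φ x) α
  have hs : Antitone s := fun t u htu => sdiff_subset_sdiff_right (biUnion_subset_biUnion_left htu)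
  have : NeBot (⨅ t, 𝓟 (s t)) := iInf_neBot_of_directed'
    (directed_of_isDirected_le fun _ _ htu => principal_mono.2 (hs htu))
    fun t => principal_neBot_iff.2 (sdiff_nonempty.2 (hcov t))
  have hmem : ∀ t, s t ∈ Ultrafilter.of (⨅ t, 𝓟 (s t)) := fun t =>
    Ultrafilter.of_le _ (mem_iInf_of_mem t (mem_principal_self _))
  obtain ⟨F, hF⟩ := exists_levyClose_of_isTailBound (Ultrafilter.of (⨅ t, 𝓟 (s t)))
    (mem_of_superset (hmem ∅) sdiff_subset) hT
  obtain ⟨δ, hδ, h⟩ := exists_levyClose_lt (hΦ F) hm hmα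
  rw [ENNReal.ofReal_toReal hα] at h
  obtain ⟨K, hK, hKs⟩ := ((hF δ hδ).and (hmem {F})).exists
  exact hKs.2 (mem_iUnion₂.2 ⟨F, Finset.mem_singleton_self F, h K hK⟩)

/-! ### Weak convergence and tightness -/

/-- The distribution of a cdf as a bundled probability measure. -/
noncomputable def toProbabilityMeasure (F : Cdf) : ProbabilityMeasure ℝ :=
  ⟨F.measure, inferInstance⟩

theorem tendsto_iff_probabilityMeasure {ι : Type*} {l : Filter ι} {a : ι → Cdf} {F : Cdf} :
    Tendsto a l (𝓝 F) ↔
      Tendsto (fun i => (a i).toProbabilityMeasure) l (𝓝 F.toProbabilityMeasure) := by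
  rw [ProbabilityMeasure.tendsto_iff_forall_integral_tendsto, nhds_iInf, tendsto_iInf]
  refine forall_congr' fun h => ?_
  rw [nhds_induced, tendsto_comap_iff]
  rfl

theorem measure_Iic (F : Cdf) (x : ℝ) : F.measure (Iic x) = ENNReal.ofReal (F x) := by
  rw [measure, StieltjesFunction.measure_Iic _ F.tendsto_atBot, sub_zero]

theorem measure_Ioi (F : Cdf) (x : ℝ) : F.measure (Ioi x) = ENNReal.ofReal (1 - F x) := by
  rw [measure, StieltjesFunction.measure_Ioi _ F.tendsto_atTop]

/-- The portmanteau inequality for the closed half-lines `Iic (-M)` and `Ici M` bounds the limsup of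
the tail masses by those of `F`. -/
theorem exists_eventually_tail_of_tendsto {a : ℕ → Cdf} {F : Cdf} (h : Tendsto a atTop (𝓝 F))
    {β : ℝ} (hβ : 0 < β) :
    ∃ M : ℝ, ∀ᶠ n in atTop, a n (-M) ≤ β ∧ 1 - β ≤ a n M := by
  rw [tendsto_iff_probabilityMeasure] at h
  obtain ⟨M, hb, ht⟩ := (((F.tendsto_atBot.comp tendsto_neg_atTop_atBot).eventually
    (gt_mem_nhds hβ)).and ((F.tendsto_atTop.comp (tendsto_atTop_add_const_right _ (-1)
      tendsto_id)).eventually (lt_mem_nhds (show 1 - β < 1 by linarith)))).exists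
  simp only [Function.comp_apply, id] at hb ht
  have h1 : limsup (fun n => (a n).measure (Iic (-M))) atTop < ENNReal.ofReal β := by
    refine (ProbabilityMeasure.limsup_measure_closed_le_of_tendsto h isClosed_Iic).trans_lt ?_
    change F.measure (Iic (-M)) < _
    rw [measure_Iic]
    exact (ENNReal.ofReal_lt_ofReal_iff hβ).2 hb
  have h2 : limsup (fun n => (a n).measure (Ici M)) atTop < ENNReal.ofReal β := by
    refine (ProbabilityMeasure.limsup_measure_closed_le_of_tendsto h isClosed_Ici).trans_lt ?_
    change F.measure (Ici M) < _
    -- Enlarging the half-line by 1 avoids the left limit of `F` at `M`; this is why `M` was chosen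
    -- with `F (M - 1)` close to 1.
    refine (measure_mono (t := Ioi (M + -1)) fun x (hx : M ≤ x) => ?_).trans_lt ?_
    · exact mem_Ioi.2 (by linarith)
    · rw [measure_Ioi]
      exact (ENNReal.ofReal_lt_ofReal_iff hβ).2 (by linarith)
  refine ⟨M, ?_⟩
  filter_upwards [eventually_lt_of_limsup_lt h1, eventually_lt_of_limsup_lt h2] with n e1 e2
  rw [measure_Iic, ENNReal.ofReal_lt_ofReal_iff hβ] at e1
  have e3 := (measure_mono (μ := (a n).measure) (Ioi_subset_Ici (le_refl M))).trans_lt e2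
  rw [measure_Ioi, ENNReal.ofReal_lt_ofReal_iff hβ] at e3
  exact ⟨e1.le, by linarith⟩

/-- Convergence at the continuity points of the limit implies weak convergence. -/
theorem tendsto_of_tendsto_continuousAt {ι : Type*} {l : Filter ι} [l.IsCountablyGenerated]
    {a : ι → Cdf} {F : Cdf}
    (h : ∀ x, ContinuousAt F x → Tendsto (fun i => a i x) l (𝓝 (F x))) :
    Tendsto a l (𝓝 F) := by
  rw [tendsto_iff_probabilityMeasure]
  have hdense : Dense {x | ContinuousAt F x} := by
    have := F.mono.countable_not_continuousAt.dense_compl ℝ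
    rwa [show {x | ¬ ContinuousAt F x}ᶜ = {x | ContinuousAt F x} by ext; simp] at this
  -- Half-open intervals with endpoints at continuity points form a π-system. Since `F` has
  -- countably many jumps, such endpoints are dense, so these intervals supply arbitrarily small
  -- neighbourhoods of each point.
  refine IsPiSystem.tendsto_probabilityMeasure_of_tendsto_of_mem
    (S := {s | ∃ x y, ContinuousAt F x ∧ ContinuousAt F y ∧ s = Ioc x y}) ?_ ?_ ?_ ?_
  · rintro _ ⟨x, y, hx, hy, rfl⟩ _ ⟨x', y', hx', hy', rfl⟩ _
    refine ⟨max x x', min y y', ?_, ?_, Ioc_inter_Ioc⟩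
    · rcases max_choice x x' with e | e <;> rwa [e]
    · rcases min_choice y y' with e | e <;> rwa [e]
  · rintro _ ⟨x, y, -, -, rfl⟩
    exact measurableSet_Ioc
  · intro u hu x hx
    obtain ⟨p, q, hpq, hsub⟩ := mem_nhds_iff_exists_Ioo_subset.1 (hu.mem_nhds hx)
    obtain ⟨p', hp', h1, h2⟩ := hdense.exists_between hpq.1
    obtain ⟨q', hq', h3, h4⟩ := hdense.exists_between hpq.2
    exact ⟨_, ⟨p', q', hp', hq', rfl⟩, Ioc_mem_nhds h2 h3,
      fun z hz => hsub ⟨h1.trans hz.1, hz.2.trans_lt h4⟩⟩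
  · rintro _ ⟨x, y, hx, hy, rfl⟩
    rw [← ENNReal.tendsto_coe]
    simp only [ProbabilityMeasure.ennreal_coeFn_eq_coeFn_toMeasure]
    change Tendsto (fun i => (a i).measure (Ioc x y)) l (𝓝 (F.measure (Ioc x y)))
    simp only [measure, StieltjesFunction.measure_Ioc]
    exact ENNReal.tendsto_ofReal ((h y hy).sub (h x hx))

theorem tendsto_of_eventually_levyClose {ι : Type*} {l : Filter ι} [l.IsCountablyGenerated]
    {a : ι → Cdf} {F : Cdf} (h : ∀ δ > 0, ∀ᶠ i in l, F.LevyClose δ δ (a i)) :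
    Tendsto a l (𝓝 F) := by
  refine tendsto_of_tendsto_continuousAt fun x hx => Metric.tendsto_nhds.2 fun ε hε => ?_
  obtain ⟨η, hη, hF⟩ := Metric.continuousAt_iff.1 hx (ε / 2) (half_pos hε)
  have hp : 0 < min (η / 2) (ε / 2) := lt_min (half_pos hη) (half_pos hε)
  have hle : min (η / 2) (ε / 2) ≤ ε / 2 := min_le_right _ _
  have hlt : min (η / 2) (ε / 2) < η := (min_le_left _ _).trans_lt (half_lt_self hη)
  filter_upwards [h _ hp] with i hi
  have h1 := @hF (x + min (η / 2) (ε / 2)) (by simpa [Real.dist_eq, abs_of_pos hp] using hlt)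
  have h2 := @hF (x - min (η / 2) (ε / 2)) (by simpa [Real.dist_eq, abs_of_pos hp] using hlt)
  rw [Real.dist_eq, abs_lt] at h1 h2 ⊢
  constructor <;> linarith [(hi x).1, (hi x).2]

/-! ### Both indices as the asymptotic tail mass -/

/-- The index of relative sequential compactness is the asymptotic tail mass. -/
theorem chiRsc_eq_sInf (D : Set Cdf) :
    continuityApproach.chiRsc D = sInf {α | 0 < α ∧ α ≠ ⊤ ∧ IsTailBound D α.toReal} :=
  le_antisymm
    (sInf_le_sInf_of_forall_lt fun _ _ _ hab hb h => isEpsRelSeqCompact_of_isTailBound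
      ENNReal.toReal_nonneg (fun _ hε => h.mono (by linarith)) hb (ENNReal.toReal_strict_mono hb hab))
    (sInf_le_sInf_of_forall_lt fun _ _ _ hab hb h =>
      isTailBound_of_isEpsRelSeqCompact hab.ne_top h (ENNReal.toReal_strict_mono hb hab))

/-- The index of relative compactness is the asymptotic tail mass. -/
theorem chiRc_eq_sInf (D : Set Cdf) :
    continuityApproach.chiRc D = sInf {α | 0 < α ∧ α ≠ ⊤ ∧ IsTailBound D α.toReal} :=
  le_antisymm
    (sInf_le_sInf_of_forall_lt fun _ _ _ hab hb h => isEpsRelCompact_of_isTailBound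
      ENNReal.toReal_nonneg (fun _ hε => h.mono (by linarith)) hb (ENNReal.toReal_strict_mono hb hab))
    (sInf_le_sInf_of_forall_lt fun _ _ _ hab hb h =>
      isTailBound_of_isEpsRelCompact hab.ne_top h (ENNReal.toReal_strict_mono hb hab))

theorem chiRsc_eq_zero_iff (D : Set Cdf) :
    continuityApproach.chiRsc D = 0 ↔ ∀ ε > 0, IsTailBound D ε := by
  rw [chiRsc_eq_sInf]
  constructor
  · intro h ε hε
    obtain ⟨α, ⟨-, hα, hT⟩, hlt⟩ := sInf_lt_iff.1 (h.trans_lt (ENNReal.ofReal_pos.2 hε))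
    exact hT.mono (ENNReal.toReal_le_of_le_ofReal hε.le hlt.le)
  · intro h
    refine le_antisymm (ENNReal.le_of_forall_pos_le_add fun ε hε _ => ?_) zero_le
    rw [zero_add]
    exact sInf_le ⟨by simpa using hε, ENNReal.coe_ne_top, h _ (by simpa using hε)⟩

/-- Relative sequential compactness in the weak topology is tightness. -/
theorem isWeaklyRelSeqCompact_iff (D : Set Cdf) :
    IsWeaklyRelSeqCompact D ↔ ∀ ε > 0, IsTailBound D ε := by
  constructor
  · intro h ε hε
    refine isTailBound_of_seq fun a ha => ?_
    obtain ⟨k, hk, F, hF⟩ := h a ha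
    exact ⟨k, hk, exists_eventually_tail_of_tendsto hF hε⟩
  · intro h a ha
    obtain ⟨k, hk, F, hF⟩ := exists_subseq_levyClose (m := 0)
      (fun ε hε => by simpa using h ε hε) a ha
    exact ⟨k, hk, F, tendsto_of_eventually_levyClose fun δ hδ => by simpa using hF δ hδ⟩

end Cdf

theorem theorem3p10 (D : Set Cdf) :
    continuityApproach.chiRsc D = continuityApproach.chiRc D ∧
      (Cdf.IsWeaklyRelSeqCompact D ↔ continuityApproach.chiRsc D = 0) :=
  ⟨(Cdf.chiRsc_eq_sInf D).trans (Cdf.chiRc_eq_sInf D).symm,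
    (Cdf.isWeaklyRelSeqCompact_iff D).trans (Cdf.chiRsc_eq_zero_iff D).symm⟩
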